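/- Let $r>0$ and $\nu>0$. Let $P_B$ be a homogeneous Poisson process with rate $\nu$ and epochs $t_1\le t_2\le\dots$, and let $B_1,B_2,\dots\ge 0$ be i.i.d. random variables, independent of $P_B$, with transform $\beta(\theta)=\mathbb E\,e^{-\theta B_1}\in[0,\infty]$, $\theta\in\mathbb R$. Let $\Lambda$ be the shot-noise process started at $\Lambda(0)=0$, $$\Lambda(t)=\sum_{i=1}^{P_B(t)}B_i\,e^{-r(t-t_i)},\qquad t\ge 0 .$$ Let $f:\mathbb R\times\mathbb R^d\to\mathbb R$ be such that for every $z\in\mathbb R^d$ the function $u\mapsto f(u,z)$ is piecewise continuous, in the sense that it has at most countably many discontinuities and is bounded on bounded intervals. Fix $z\in\mathbb R^d$, $s\in\mathbb R$ and $t\ge 0$, and put $$\theta(v)=s\,e^{-r(t-v)}-e^{rv}\int_v^t f(u,z)\,e^{-ru}\,du,\qquad 0\le v\le t .$$ Then almost surely $u\mapsto f(u,z)\Lambda(u)$ is integrable on $[0,t]$, the function $\int_0^t f(u,z)\Lambda(u)\,du-s\Lambda(t)$ is $\mathbb P$-almost everywhere equal to a random variable, and $$\mathbb E\exp\left(\int_0^t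 f(u,z)\Lambda(u)\,du-s\Lambda(t)\right)=\exp\left(\nu\int_0^t\bigl(\beta(\theta(v))-1\bigr)\,dv\right)$$ as an identity in $[0,\infty]$, where $\int_0^t(\beta(\theta(v))-1)\,dv$ means $\int_0^t\beta(\theta(v))\,dv-t\in(-\infty,\infty]$ and $\exp(\infty)=\infty$. In particular, the random variable $\exp\left(\int_0^t f(u,z)\Lambda(u)\,du-s\Lambda(t)\right)$ is integrable if and only if $\int_0^t\beta(\theta(v))\,dv<\infty$; in that case $v\mapsto\beta(\theta(v))-1$ is integrable on $[0,t]$ and the identity holds between real numbers. -/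

import Mathlib

open MeasureTheory ProbabilityTheory
open scoped NNReal ENNReal

/-- `N` is a homogeneous Poisson (counting) process with rate `ν`: it starts at `0`, its paths are
nondecreasing and right-continuous, it has independent increments, and the increment over
`(s, t]` is Poisson distributed with mean `ν (t - s)`. -/
structure IsPoissonProcess {Ω : Type*} [MeasurableSpace Ω] (N : ℝ≥0 → Ω → ℕ) (ν : ℝ≥0)
    (P : Measure Ω) : Prop where
  measurable : ∀ t, Measurable (N t)
  zero : ∀ᵐ ω ∂P, N 0 ω = 0
  mono : ∀ᵐ ω ∂P, Monotone fun t => N t ω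
  rightCts : ∀ᵐ ω ∂P, ∀ t, ContinuousWithinAt (fun u => N u ω) (Set.Ici t) t
  indep : HasIndepIncrements N P
  law : ∀ s t, s ≤ t → HasLaw (fun ω => N t ω - N s ω) (poissonMeasure (ν * (t - s))) P

/-- The epoch of the `k`-th point (`k ≥ 1`) of the counting process `N`:
the first time at which `N` has reached `k`. -/
noncomputable def epoch {Ω : Type*} (N : ℝ≥0 → Ω → ℕ) (k : ℕ) (ω : Ω) : ℝ≥0 :=
  sInf {t : ℝ≥0 | k ≤ N t ω}

/-- The sum `∑_{i=1}^{N(t)} B_i exp (-r (t - t_i))` over the points `t_1, t_2, …` of `N` up to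
time `t`. The shots are numbered from `0`, so `B i` is the shot at the `(i+1)`-st epoch. -/
noncomputable def shotSum {Ω : Type*} (r : ℝ) (N : ℝ≥0 → Ω → ℕ) (B : ℕ → Ω → ℝ)
    (t : ℝ≥0) (ω : Ω) : ℝ :=
  ∑ i ∈ Finset.range (N t ω), B i ω * Real.exp (-r * ((t : ℝ) - (epoch N (i + 1) ω : ℝ)))

/-- `Λ` is the shot-noise process, started at `Λ(0) = 0`, with exponential decay rate `r`, shot
epochs given by the Poisson process `N` of rate `ν`, and i.i.d. nonnegative shots `B`
independent of `N`. -/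
structure IsShotNoise {Ω : Type*} [MeasurableSpace Ω] (P : Measure Ω) (r : ℝ) (ν : ℝ≥0)
    (N : ℝ≥0 → Ω → ℕ) (B : ℕ → Ω → ℝ) (Λ : ℝ≥0 → Ω → ℝ) : Prop where
  decay_pos : 0 < r
  rate_pos : 0 < ν
  poisson : IsPoissonProcess N ν P
  measurable_shot : ∀ i, Measurable (B i)
  shot_nonneg : ∀ i, ∀ᵐ ω ∂P, 0 ≤ B i ω
  shot_indep : iIndepFun B P
  shot_ident : ∀ i, IdentDistrib (B i) (B 0) P P
  indep : IndepFun (fun ω t => N t ω) (fun ω i => B i ω) P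
  eq_shotSum : ∀ᵐ ω ∂P, ∀ t, Λ t ω = shotSum r N B t ω

/-- The transform `β(θ) = E exp (-θ B)` of a random variable `B`, with values in `[0, ∞]`. -/
noncomputable def transform {Ω : Type*} [MeasurableSpace Ω] (P : Measure Ω) (B : Ω → ℝ)
    (θ : ℝ) : ℝ≥0∞ :=
  ∫⁻ ω, ENNReal.ofReal (Real.exp (-θ * B ω)) ∂P

/-- Piecewise continuity on the line with at most countably many discontinuities, which are
allowed to accumulate; as usual `g` is bounded on bounded intervals. -/
structure PiecewiseContinuous (g : ℝ → ℝ) : Prop where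
  countable : {x | ¬ ContinuousAt g x}.Countable
  bounded : ∀ a b : ℝ, ∃ C : ℝ, ∀ x ∈ Set.Icc a b, |g x| ≤ C

/-- The random exponent `∫_0^t g(u) Λ(u) du - s Λ(t)`. -/
noncomputable def pathExponent {Ω : Type*} (Λ : ℝ≥0 → Ω → ℝ) (g : ℝ → ℝ) (s t : ℝ) (ω : Ω) : ℝ :=
  (∫ u in (0 : ℝ)..t, g u * Λ u.toNNReal ω) - s * Λ t.toNNReal ω

/-- The argument `s exp (-r (t - v)) - exp (r v) ∫_v^t g(u) exp (-r u) du` of the transform. -/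
noncomputable def transformArg (r : ℝ) (g : ℝ → ℝ) (s t v : ℝ) : ℝ :=
  s * Real.exp (-r * (t - v)) - Real.exp (r * v) * ∫ u in v..t, g u * Real.exp (-r * u)

/-! The exponent is linear in the shots. A shot `B` at epoch `T` contributes `B e^{rT} ∫_T^t f(u,z)
e^{-ru} du` through the path integral and `-s B e^{-r(t-T)}` through the end value, in total `-B
θ(T)`. Thus the exponent is `-∑ B_i θ(t_i)` (`pathExponent_eq`), and what remains is the exponential
formula for a marked Poisson process with continuous `θ`.

That formula is proved by discretising time. With epochs rounded up to a grid, a product over points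
becomes a product over cells (`prod_gridEpoch`). Once the i.i.d. marks are integrated out
(`lintegral_prod_marks`), each cell carries a power of an independent Poisson increment, and the
generating functions multiply to the exponential of a Riemann sum. Refining the grid gives the
formula for bounded continuous functions (`lintegral_prod_epoch`).

Since `e^{-θB}` may be unbounded, it is truncated at level `n`. Both sides increase with `n`, so
monotone convergence gives the identity in `[0, ∞]` with no finiteness assumption
(`lintegral_exp_sum_epoch`). -/

open Filter Topology

/-! ### Epochs of a counting path and their rounding to a grid -/

/-- For a monotone right-continuous counting path, the epoch of the point number `i + 1` is at
most `u` exactly when the path has passed `i` at time `u`. -/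
lemma epoch_le_iff {Ω : Type*} {N : ℝ≥0 → Ω → ℕ} {ω : Ω} (hmono : Monotone fun t => N t ω)
    (hrc : ∀ t, ContinuousWithinAt (fun u => N u ω) (Set.Ici t) t) {i : ℕ} {t : ℝ≥0}
    (hi : i < N t ω) (u : ℝ≥0) : epoch N (i + 1) ω ≤ u ↔ i < N u ω := by
  have hne : {t : ℝ≥0 | i + 1 ≤ N t ω}.Nonempty := ⟨t, hi⟩
  constructor
  · intro h
    -- The infimum is attained: the path reaches level `i + 1` at times arbitrarily close to the
    -- epoch from the right, and an integer-valued right-continuous path is constant just after it.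
    have hfreq := (isGLB_csInf hne (OrderBot.bddBelow _)).frequently_mem hne
    have hev := (hrc (epoch N (i + 1) ω)).eventually
      (show {N (epoch N (i + 1) ω) ω} ∈ 𝓝 (N (epoch N (i + 1) ω) ω) by simp)
    obtain ⟨x, hx, hx'⟩ := (hfreq.and_eventually hev).exists
    have hx'' : N x ω = N (epoch N (i + 1) ω) ω := hx'
    have hx0 : i + 1 ≤ N x ω := hx
    have := hmono h
    simp only at this
    omega
  · intro h
    exact csInf_le (OrderBot.bddBelow _) h

/-- The epoch of the point number `i + 1` of a counting path `p`, rounded up to the grid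
`0, δ, 2 δ, …, m δ`. -/
noncomputable def gridEpoch (δ : ℝ≥0) (m : ℕ) (p : ℝ≥0 → ℕ) (i : ℕ) : ℝ≥0 :=
  δ * ∑ j ∈ Finset.range m, if p (j * δ) ≤ i then 1 else 0

lemma measurable_gridEpoch (δ : ℝ≥0) (m i : ℕ) : Measurable fun p => gridEpoch δ m p i := by
  unfold gridEpoch
  refine Measurable.const_mul (Finset.measurable_sum _ fun j _ => ?_) _
  exact Measurable.ite (measurableSet_le (measurable_pi_apply _) measurable_const)
    measurable_const measurable_const

lemma gridEpoch_eq (δ : ℝ≥0) (m : ℕ) (p : ℝ≥0 → ℕ) (i : ℕ) :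
    gridEpoch δ m p i = δ * ((Finset.range m).filter fun j : ℕ => p (j * δ) ≤ i).card := by
  simp [gridEpoch]

/-- By monotonicity the grid indices counted are exactly `0, …, k`, which are `k + 1` in number, so
a point in a cell moves to the right end of that cell. -/
lemma gridEpoch_of_mem {δ : ℝ≥0} {m : ℕ} {p : ℝ≥0 → ℕ} (hp : Monotone p) {i k : ℕ}
    (hk : k < m) (h1 : p (k * δ) ≤ i) (h2 : i < p ((k + 1 : ℕ) * δ)) :
    gridEpoch δ m p i = (k + 1 : ℕ) * δ := by
  have : (Finset.range m).filter (fun j : ℕ => p (j * δ) ≤ i) = Finset.range (k + 1) := by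
    ext j
    simp only [Finset.mem_filter, Finset.mem_range]
    constructor
    · rintro ⟨-, hj⟩
      by_contra hjk
      have hkj : k + 1 ≤ j := by omega
      have : p ((k + 1 : ℕ) * δ) ≤ p (j * δ) := hp (by gcongr)
      omega
    · intro hj
      have hjk : j ≤ k := by omega
      have : p (j * δ) ≤ p (k * δ) := hp (by gcongr)
      exact ⟨by omega, by omega⟩
  rw [gridEpoch_eq, this, Finset.card_range, mul_comm]

/-- For `δ > 0` the grid times strictly before the epoch `T` are those with `j < T / δ`, so the
count is `⌈T / δ⌉` and rounding costs less than `δ`. The bound `T ≤ m δ` ensures that the grid is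
long enough. -/
lemma dist_gridEpoch_le {Ω : Type*} {N : ℝ≥0 → Ω → ℕ} {ω : Ω} (hmono : Monotone fun t => N t ω)
    (hrc : ∀ t, ContinuousWithinAt (fun u => N u ω) (Set.Ici t) t) {δ : ℝ≥0} {i m : ℕ}
    (hi : i < N (m * δ) ω) :
    dist (gridEpoch δ m (fun u => N u ω) i) (epoch N (i + 1) ω) ≤ δ := by
  have key := epoch_le_iff hmono hrc hi
  have hle := (key _).2 hi
  rcases eq_or_ne δ 0 with rfl | hδ
  · have : epoch N (i + 1) ω = 0 := by simpa using hle
    simp [gridEpoch, this]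
  · have hδ' : 0 < δ := pos_iff_ne_zero.2 hδ
    have hset : (Finset.range m).filter (fun j : ℕ => N (j * δ) ω ≤ i) =
        Finset.range ⌈epoch N (i + 1) ω / δ⌉₊ := by
      ext j
      simp only [Finset.mem_filter, Finset.mem_range, Nat.lt_ceil, lt_div_iff₀ hδ']
      rw [← not_lt, ← key, not_le, and_iff_right_iff_imp]
      intro hj
      exact_mod_cast lt_of_mul_lt_mul_right (hj.trans_le hle) hδ'.le
    rw [gridEpoch_eq, hset, Finset.card_range, NNReal.dist_eq]
    have h1 := Nat.le_ceil (epoch N (i + 1) ω / δ)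
    have h2 := Nat.ceil_lt_add_one (zero_le : 0 ≤ epoch N (i + 1) ω / δ)
    rw [div_le_iff₀ hδ'] at h1
    rw [← mul_lt_mul_iff_left₀ hδ', add_mul, div_mul_cancel₀ _ hδ, one_mul] at h2
    rw [← NNReal.coe_le_coe] at h1
    rw [← NNReal.coe_lt_coe] at h2
    push_cast at h1 h2 ⊢
    rw [abs_le]
    constructor <;> linarith

/-- A product over the points of a counting path, with their epochs rounded up to the grid, is a
product over the cells of the grid. -/
lemma prod_gridEpoch {M : Type*} [CommMonoid M] {δ : ℝ≥0} {m : ℕ} {p : ℝ≥0 → ℕ}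
    (hp : Monotone p) (h0 : p 0 = 0) (h : ℝ≥0 → M) :
    ∏ i ∈ Finset.range (p (m * δ)), h (gridEpoch δ m p i) =
      ∏ j ∈ Finset.range m, h ((j + 1 : ℕ) * δ) ^ (p ((j + 1 : ℕ) * δ) - p (j * δ)) := by
  -- The induction runs over the number of cells used, while the grid that defines the rounding
  -- stays fixed.
  suffices H : ∀ k ≤ m, ∏ i ∈ Finset.range (p (k * δ)), h (gridEpoch δ m p i) =
      ∏ j ∈ Finset.range k, h ((j + 1 : ℕ) * δ) ^ (p ((j + 1 : ℕ) * δ) - p (j * δ)) from H m le_rfl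
  intro k hk
  induction k with
  | zero => simp [h0]
  | succ k ih =>
    have hkk : p (k * δ) ≤ p ((k + 1 : ℕ) * δ) := hp (by gcongr; simp)
    rw [Finset.prod_range_succ, ← ih (by omega), ← Finset.prod_range_mul_prod_Ico _ hkk]
    congr 1
    rw [Finset.prod_congr rfl fun i hi => by
      rw [gridEpoch_of_mem hp (by omega : k < m) (Finset.mem_Ico.1 hi).1 (Finset.mem_Ico.1 hi).2]]
    simp

/-! ### Poisson generating functions over the grid -/

/-- The probability generating function of the Poisson distribution. -/
lemma lintegral_pow_poissonMeasure (l c : ℝ≥0) :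
    ∫⁻ k, (c : ℝ≥0∞) ^ k ∂(poissonMeasure l) =
      ENNReal.ofReal (Real.exp (l * ((c : ℝ) - 1))) := by
  have hs : HasSum (fun n : ℕ => Real.exp (-l) * (((l : ℝ) * c) ^ n / n.factorial))
      (Real.exp (-l) * Real.exp (l * c)) := by
    refine HasSum.mul_left _ ?_
    rw [Real.exp_eq_exp_ℝ]
    exact NormedSpace.expSeries_div_hasSum_exp _
  have : Real.exp (l * ((c : ℝ) - 1)) = Real.exp (-l) * Real.exp (l * c) := by
    rw [← Real.exp_add]; ring_nf
  rw [this, lintegral_countable', ← hs.tsum_eq, ENNReal.ofReal_tsum_of_nonneg _ hs.summable]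
  · refine tsum_congr fun n => ?_
    rw [poissonMeasure_singleton, ← ENNReal.ofReal_coe_nnreal, ← ENNReal.ofReal_pow (by simp),
      ← ENNReal.ofReal_mul (by positivity)]
    congr 1
    rw [mul_pow]; ring
  · intro n; positivity

namespace IsPoissonProcess

variable {Ω : Type*} [MeasurableSpace Ω] {P : Measure Ω} {N : ℝ≥0 → Ω → ℕ} {ν : ℝ≥0}

lemma lintegral_pow_increment (hN : IsPoissonProcess N ν P) (c : ℝ≥0) {s t : ℝ≥0} (hst : s ≤ t) :
    ∫⁻ ω, (c : ℝ≥0∞) ^ (N t ω - N s ω) ∂P =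
      ENNReal.ofReal (Real.exp (ν * (t - s) * ((c : ℝ) - 1))) := by
  have hl := hN.law s t hst
  have := lintegral_pow_poissonMeasure (ν * (t - s)) c
  rw [← hl.map_eq, lintegral_map' (by fun_prop) hl.aemeasurable] at this
  rw [this]
  push_cast [NNReal.coe_sub hst]
  rfl

lemma lintegral_pow (hN : IsPoissonProcess N ν P) (c t : ℝ≥0) :
    ∫⁻ ω, (c : ℝ≥0∞) ^ N t ω ∂P = ENNReal.ofReal (Real.exp (ν * t * ((c : ℝ) - 1))) := by
  have := hN.lintegral_pow_increment c (zero_le : 0 ≤ t)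
  simp only [NNReal.coe_zero, sub_zero] at this
  rw [← this]
  refine lintegral_congr_ae ?_
  filter_upwards [hN.zero] with ω h
  simp [h]

/-- Increments over distinct cells are independent, so the expectation factors into terms `exp (ν δ
(c - 1))`, whose exponents add up to a right-endpoint Riemann sum. -/
lemma lintegral_prod_gridEpoch (hN : IsPoissonProcess N ν P) (c : ℝ≥0 → ℝ≥0) (δ : ℝ≥0) (m : ℕ) :
    ∫⁻ ω, ∏ i ∈ Finset.range (N (m * δ) ω), (c (gridEpoch δ m (fun u => N u ω) i) : ℝ≥0∞) ∂P =
      ENNReal.ofReal (Real.exp (ν *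
        ((∑ j ∈ Finset.range m, (δ : ℝ) * c ((j + 1 : ℕ) * δ)) - m * δ))) := by
  have hgrid : Monotone fun j : ℕ => (j : ℝ≥0) * δ := fun a b hab => by
    dsimp only; gcongr
  have hind := (hN.indep.nat hgrid).comp
    (fun j k => (c ((j + 1 : ℕ) * δ) : ℝ≥0∞) ^ k) (fun j => by fun_prop)
  have hmeas : ∀ j : ℕ, Measurable ((fun k => (c ((j + 1 : ℕ) * δ) : ℝ≥0∞) ^ k) ∘
      fun ω => N ((j + 1 : ℕ) * δ) ω - N (j * δ) ω) := fun j =>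
    (by fun_prop : Measurable fun k : ℕ => (c ((j + 1 : ℕ) * δ) : ℝ≥0∞) ^ k).comp
      ((hN.measurable _).sub (hN.measurable _))
  have hprod := lintegral_prod_eq_prod_lintegral_of_indepFun (Finset.range m) _ hind hmeas
  simp only [Function.comp_apply] at hprod
  calc _ = ∫⁻ ω, ∏ j ∈ Finset.range m, (c ((j + 1 : ℕ) * δ) : ℝ≥0∞) ^
        (N ((j + 1 : ℕ) * δ) ω - N (j * δ) ω) ∂P := by
        refine lintegral_congr_ae ?_
        filter_upwards [hN.zero, hN.mono] with ω h0 hmono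
        exact prod_gridEpoch (p := fun u => N u ω) hmono h0 fun u => (c u : ℝ≥0∞)
    _ = _ := by
        rw [hprod, Finset.prod_congr rfl fun j _ => hN.lintegral_pow_increment _
          (hgrid (Nat.le_succ j)), ← ENNReal.ofReal_prod_of_nonneg fun _ _ => (Real.exp_pos _).le,
          ← Real.exp_sum]
        congr 2
        rw [mul_sub, Finset.mul_sum]
        have : (ν : ℝ) * (m * δ) = ∑ j ∈ Finset.range m, (ν * δ : ℝ) := by simp; ring
        rw [this, ← Finset.sum_sub_distrib]
        refine Finset.sum_congr rfl fun j _ => ?_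
        push_cast; ring

end IsPoissonProcess

/-! ### Convergence of Riemann sums -/

/-- Right-endpoint Riemann sums of a continuous function converge to its integral. -/
lemma tendsto_riemannSum {c : ℝ → ℝ} (hc : Continuous c) {t : ℝ} (ht : 0 ≤ t) :
    Tendsto (fun m : ℕ => ∑ j ∈ Finset.range (m + 1),
      t / (m + 1 : ℕ) * c ((j + 1 : ℕ) * (t / (m + 1 : ℕ)))) atTop (𝓝 (∫ v in (0 : ℝ)..t, c v)) := by
  rw [Metric.tendsto_atTop]
  intro ε hε
  have huc : UniformContinuousOn c (Set.Icc 0 t) :=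
    isCompact_Icc.uniformContinuousOn_of_continuous hc.continuousOn
  rw [Metric.uniformContinuousOn_iff_le] at huc
  -- With this tolerance the cell errors add up to at most `ε t / (t + 1) < ε`, also when `t = 0`.
  obtain ⟨η, hη, hcη⟩ := huc (ε / (t + 1)) (by positivity)
  obtain ⟨M, hM⟩ := exists_nat_gt (t / η)
  refine ⟨M, fun m hm => ?_⟩
  set δ : ℝ := t / (m + 1 : ℕ) with hδdef
  have hm1 : (0 : ℝ) < (m + 1 : ℕ) := by positivity
  have hδ : 0 ≤ δ := by positivity
  have hmδ : ((m + 1 : ℕ) : ℝ) * δ = t := by rw [hδdef]; field_simp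
  have hδη : δ ≤ η := by
    rw [hδdef, div_le_iff₀ hm1]
    rw [div_lt_iff₀ hη] at hM
    have : (M : ℝ) ≤ (m + 1 : ℕ) := by exact_mod_cast hm.trans (Nat.le_succ m)
    nlinarith
  have hsplit : ∫ v in (0 : ℝ)..t, c v =
      ∑ j ∈ Finset.range (m + 1), ∫ v in (j * δ)..((j + 1 : ℕ) * δ), c v := by
    rw [intervalIntegral.sum_integral_adjacent_intervals (a := fun j : ℕ => (j : ℝ) * δ)
      fun k _ => hc.intervalIntegrable _ _]
    rw [hmδ]; simp
  have hcell : ∀ j ∈ Finset.range (m + 1),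
      ‖δ * c ((j + 1 : ℕ) * δ) - ∫ v in (j * δ)..((j + 1 : ℕ) * δ), c v‖ ≤ ε / (t + 1) * δ := by
    intro j hj
    have hjm : ((j + 1 : ℕ) : ℝ) ≤ (m + 1 : ℕ) := by
      exact_mod_cast Finset.mem_range.1 hj
    have hlen : ((j + 1 : ℕ) : ℝ) * δ - j * δ = δ := by push_cast; ring
    have h1 : δ * c ((j + 1 : ℕ) * δ) =
        ∫ _ in (j * δ)..((j + 1 : ℕ) * δ), c ((j + 1 : ℕ) * δ) := by
      rw [intervalIntegral.integral_const, hlen, smul_eq_mul]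
    rw [h1, ← intervalIntegral.integral_sub (by simp) (hc.intervalIntegrable _ _)]
    have h2 := intervalIntegral.norm_integral_le_of_norm_le_const
      (a := (j : ℝ) * δ) (b := (j + 1 : ℕ) * δ) (C := ε / (t + 1))
      (f := fun v => c ((j + 1 : ℕ) * δ) - c v) ?_
    · rwa [hlen, abs_of_nonneg hδ] at h2
    · intro v hv
      rw [Set.uIoc_of_le (by linarith)] at hv
      have hj0 : (0 : ℝ) ≤ j * δ := by positivity
      have hjt : ((j + 1 : ℕ) : ℝ) * δ ≤ t := by rw [← hmδ]; gcongr
      rw [← dist_eq_norm]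
      refine hcη _ ⟨by positivity, hjt⟩ _ ⟨by linarith [hv.1], hv.2.trans hjt⟩ ?_
      rw [Real.dist_eq, abs_of_nonneg (by linarith [hv.2])]
      linarith [hv.1]
  rw [hsplit, dist_eq_norm, ← Finset.sum_sub_distrib]
  refine (norm_sum_le_of_le _ hcell).trans_lt ?_
  rw [Finset.sum_const, Finset.card_range, nsmul_eq_mul, mul_left_comm, hmδ, div_mul_eq_mul_div,
    div_lt_iff₀ (by positivity)]
  nlinarith

/-! ### Random products and integration over the marks -/

/-- The number of factors takes countably many values, so measurability can be checked with that
number frozen. -/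
lemma measurable_prod_range {X : Type*} [MeasurableSpace X] {k : X → ℕ} (hk : Measurable k)
    {g : ℕ → X → ℝ≥0∞} (hg : ∀ i, Measurable (g i)) :
    Measurable fun x => ∏ i ∈ Finset.range (k x), g i x := by
  have : Measurable fun q : X × ℕ => ∏ i ∈ Finset.range q.2, g i q.1 :=
    measurable_from_prod_countable_left fun n =>
      Finset.measurable_prod (Finset.range n) fun i _ => hg i
  exact this.comp (measurable_id.prodMk hk)

lemma measurable_sum_range {X : Type*} [MeasurableSpace X] {k : X → ℕ} (hk : Measurable k)
    {g : ℕ → X → ℝ} (hg : ∀ i, Measurable (g i)) :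
    Measurable fun x => ∑ i ∈ Finset.range (k x), g i x := by
  have : Measurable fun q : X × ℕ => ∑ i ∈ Finset.range q.2, g i q.1 :=
    measurable_from_prod_countable_left fun n =>
      Finset.measurable_sum (Finset.range n) fun i _ => hg i
  exact this.comp (measurable_id.prodMk hk)

/-- Integrating out i.i.d. marks which are independent of a randomly indexed, random family of
positions. -/
lemma lintegral_prod_marks {Ω S Y : Type*} [MeasurableSpace Ω] [MeasurableSpace S]
    [MeasurableSpace Y] {P : Measure Ω} [IsProbabilityMeasure P] {Z : Ω → Y} (hZ : Measurable Z)
    {B : ℕ → Ω → ℝ} (hB : ∀ i, Measurable (B i)) (hindB : iIndepFun B P)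
    (hid : ∀ i, IdentDistrib (B i) (B 0) P P) (hind : IndepFun Z (fun ω i => B i ω) P)
    {k : Y → ℕ} (hk : Measurable k) {τ : ℕ → Y → S} (hτ : ∀ i, Measurable (τ i))
    {φ : S → ℝ → ℝ≥0∞} (hφ : Measurable (Function.uncurry φ)) :
    ∫⁻ ω, ∏ i ∈ Finset.range (k (Z ω)), φ (τ i (Z ω)) (B i ω) ∂P =
      ∫⁻ ω, ∏ i ∈ Finset.range (k (Z ω)), ∫⁻ ω', φ (τ i (Z ω)) (B 0 ω') ∂P ∂P := by
  have hB' : Measurable fun ω i => B i ω := measurable_pi_lambda _ hB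
  have hF : Measurable fun q : Y × (ℕ → ℝ) => ∏ i ∈ Finset.range (k q.1), φ (τ i q.1) (q.2 i) :=
    measurable_prod_range (hk.comp measurable_fst) fun i =>
      hφ.comp (((hτ i).comp measurable_fst).prodMk ((measurable_pi_apply i).comp measurable_snd))
  have hG : Measurable fun y => ∏ i ∈ Finset.range (k y), ∫⁻ ω', φ (τ i y) (B 0 ω') ∂P := by
    refine measurable_prod_range hk fun i => ?_
    exact Measurable.lintegral_prod_right
      (hφ.comp (((hτ i).comp measurable_fst).prodMk ((hB 0).comp measurable_snd)))
  have hφ1 : ∀ x, Measurable (φ x) := fun x => hφ.comp measurable_prodMk_left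
  have : IsProbabilityMeasure (P.map Z) := Measure.isProbabilityMeasure_map hZ.aemeasurable
  have : IsProbabilityMeasure (P.map fun ω i => B i ω) :=
    Measure.isProbabilityMeasure_map hB'.aemeasurable
  calc _ = ∫⁻ q, ∏ i ∈ Finset.range (k q.1), φ (τ i q.1) (q.2 i)
          ∂(P.map fun ω => (Z ω, fun i => B i ω)) := by
        rw [lintegral_map hF (hZ.prodMk hB')]
    _ = ∫⁻ y, ∫⁻ b, ∏ i ∈ Finset.range (k y), φ (τ i y) (b i)
          ∂(P.map fun ω i => B i ω) ∂(P.map Z) := by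
        rw [hind.map_prod_eq_prod_map_map hZ.aemeasurable hB'.aemeasurable,
          lintegral_prod _ hF.aemeasurable]
    _ = ∫⁻ y, ∏ i ∈ Finset.range (k y), ∫⁻ ω', φ (τ i y) (B 0 ω') ∂P ∂(P.map Z) := by
        -- With the path `y` frozen, the number and positions of the factors are deterministic, and
        -- independence and the common law of the marks apply.
        refine lintegral_congr fun y => ?_
        have hFy : Measurable fun b : ℕ → ℝ => ∏ i ∈ Finset.range (k y), φ (τ i y) (b i) :=
          hF.comp measurable_prodMk_left
        rw [lintegral_map hFy hB']
        rw [lintegral_prod_eq_prod_lintegral_of_indepFun _ (fun i ω => φ (τ i y) (B i ω))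
          (hindB.comp (fun i => φ (τ i y)) fun i => hφ1 _) fun i => (hφ1 _).comp (hB i)]
        exact Finset.prod_congr rfl fun i _ => ((hid i).comp (hφ1 (τ i y))).lintegral_eq
    _ = _ := lintegral_map hG hZ

lemma tendsto_prod_of_tendsto {φ : ℝ → ℝ → ℝ≥0} (hφ : Continuous (Function.uncurry φ))
    {k : ℕ} {τ : ℕ → ℕ → ℝ≥0} {T : ℕ → ℝ≥0} {b : ℕ → ℝ}
    (h : ∀ i < k, Tendsto (fun m => τ m i) atTop (𝓝 (T i))) :
    Tendsto (fun m => ∏ i ∈ Finset.range k, (φ (τ m i) (b i) : ℝ≥0∞)) atTop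
      (𝓝 (∏ i ∈ Finset.range k, (φ (T i) (b i) : ℝ≥0∞))) := by
  have hφ1 : ∀ b, Continuous fun v => φ v b := fun b =>
    hφ.comp (by fun_prop : Continuous fun v : ℝ => (v, b))
  -- The limit is taken in `ℝ≥0`, because multiplication on `ℝ≥0∞` is not continuous at `(0, ∞)`.
  simp only [← ENNReal.ofNNReal_finsetProd]
  refine ENNReal.tendsto_coe.2 (tendsto_finsetProd _ fun i hi => ?_)
  exact ((hφ1 _).tendsto _).comp ((NNReal.continuous_coe.tendsto _).comp
    (h i (Finset.mem_range.1 hi)))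

/-! ### Product formula for bounded continuous functions -/

namespace IsShotNoise

variable {Ω : Type*} [MeasurableSpace Ω] {P : Measure Ω} {r : ℝ}
  {ν : ℝ≥0} {N : ℝ≥0 → Ω → ℕ} {B : ℕ → Ω → ℝ} {Λ : ℝ≥0 → Ω → ℝ}

/-- The epochs of the points up to time `t`, rounded up to finer and finer grids, converge. -/
lemma tendsto_gridEpoch (hΛ : IsShotNoise P r ν N B Λ) (t : ℝ≥0) :
    ∀ᵐ ω ∂P, ∀ i < N t ω,
      Tendsto (fun m : ℕ => gridEpoch (t / (m + 1 : ℕ)) (m + 1) (fun u => N u ω) i) atTop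
        (𝓝 (epoch N (i + 1) ω)) := by
  filter_upwards [hΛ.poisson.mono, hΛ.poisson.rightCts] with ω hmono hrc i hi
  rw [tendsto_iff_dist_tendsto_zero]
  have hlim : Tendsto (fun m : ℕ => (t : ℝ) / ((m : ℝ) + 1)) atTop (𝓝 0) :=
    tendsto_const_div_atTop_nhds_zero_nat (t : ℝ) |>.comp (tendsto_add_atTop_nat 1) |>.congr
      fun m => by simp
  refine squeeze_zero (fun _ => dist_nonneg) (fun m => ?_) hlim
  have hmt : ((m + 1 : ℕ) : ℝ≥0) * (t / (m + 1 : ℕ)) = t := by field_simp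
  have := dist_gridEpoch_le (δ := t / (m + 1 : ℕ)) (m := m + 1) hmono hrc (by rwa [hmt])
  simpa using this

lemma measurable_path (hΛ : IsShotNoise P r ν N B Λ) : Measurable fun ω t => N t ω :=
  measurable_pi_lambda _ hΛ.poisson.measurable

/-- An epoch is an infimum over uncountably many times. Its rounded version depends on finitely many
path values, so measurability passes to the almost sure limit. -/
lemma aemeasurable_sum_epoch (hΛ : IsShotNoise P r ν N B Λ) (t : ℝ≥0) {θ : ℝ → ℝ}
    (hθ : Continuous θ) :
    AEMeasurable (fun ω => ∑ i ∈ Finset.range (N t ω), B i ω * θ (epoch N (i + 1) ω)) P := by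
  refine aemeasurable_of_tendsto_metrizable_ae' (f := fun m ω => ∑ i ∈ Finset.range (N t ω),
    B i ω * θ (gridEpoch (t / (m + 1 : ℕ)) (m + 1) (fun u => N u ω) i)) (fun m => ?_) ?_
  · refine (measurable_sum_range (hΛ.poisson.measurable t) fun i => ?_).aemeasurable
    exact (hΛ.measurable_shot i).mul (hθ.measurable.comp (measurable_subtype_coe.comp
      ((measurable_gridEpoch _ _ i).comp hΛ.measurable_path)))
  · filter_upwards [hΛ.tendsto_gridEpoch t] with ω h
    refine tendsto_finsetSum _ fun i hi => Tendsto.const_mul _ ?_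
    exact (hθ.tendsto _).comp ((NNReal.continuous_coe.tendsto _).comp (h i (Finset.mem_range.1 hi)))

lemma measurable_prod_gridEpoch (hΛ : IsShotNoise P r ν N B Λ) (t δ : ℝ≥0) (m : ℕ)
    {φ : ℝ → ℝ → ℝ≥0} (hφ : Measurable (Function.uncurry φ)) :
    Measurable fun ω => ∏ i ∈ Finset.range (N t ω),
      (φ (gridEpoch δ m (fun u => N u ω) i) (B i ω) : ℝ≥0∞) :=
  measurable_prod_range (hΛ.poisson.measurable t) fun i =>
    (hφ.comp ((measurable_subtype_coe.comp
      ((measurable_gridEpoch _ _ i).comp hΛ.measurable_path)).prodMk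
        (hΛ.measurable_shot i))).coe_nnreal_ennreal

lemma aemeasurable_prod_epoch (hΛ : IsShotNoise P r ν N B Λ) (t : ℝ≥0) {φ : ℝ → ℝ → ℝ≥0}
    (hφ : Continuous (Function.uncurry φ)) :
    AEMeasurable (fun ω => ∏ i ∈ Finset.range (N t ω),
      (φ (epoch N (i + 1) ω) (B i ω) : ℝ≥0∞)) P := by
  refine aemeasurable_of_tendsto_metrizable_ae' (f := fun m ω => ∏ i ∈ Finset.range (N t ω),
    (φ (gridEpoch (t / (m + 1 : ℕ)) (m + 1) (fun u => N u ω) i) (B i ω) : ℝ≥0∞))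
    (fun m => (hΛ.measurable_prod_gridEpoch t _ _ hφ.measurable).aemeasurable) ?_
  filter_upwards [hΛ.tendsto_gridEpoch t] with ω h using tendsto_prod_of_tendsto hφ h

/-- The marked Poisson product formula, for bounded continuous functions of epoch and mark. -/
lemma lintegral_prod_epoch [IsProbabilityMeasure P] (hΛ : IsShotNoise P r ν N B Λ) (t : ℝ≥0) {φ : ℝ → ℝ → ℝ≥0}
    (hφ : Continuous (Function.uncurry φ)) {K : ℝ≥0} (hK : ∀ v b, φ v b ≤ K) :
    ∫⁻ ω, ∏ i ∈ Finset.range (N t ω), (φ (epoch N (i + 1) ω) (B i ω) : ℝ≥0∞) ∂P =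
      ENNReal.ofReal (Real.exp (ν *
        ((∫ v in (0 : ℝ)..t, ∫ ω, (φ v (B 0 ω) : ℝ) ∂P) - t))) := by
  set c : ℝ → ℝ := fun v => ∫ ω, (φ v (B 0 ω) : ℝ) ∂P with hcdef
  have hφ1 : ∀ b, Continuous fun v => φ v b := fun b => by
    exact hφ.comp (by fun_prop : Continuous fun v : ℝ => (v, b))
  have hmeas : ∀ v, Measurable fun ω => φ v (B 0 ω) := fun v =>
    (hφ.measurable.comp measurable_prodMk_left).comp (hΛ.measurable_shot 0)
  have hbound : ∀ v, ∀ᵐ ω ∂P, ‖(φ v (B 0 ω) : ℝ)‖ ≤ K := fun v =>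
    ae_of_all _ fun ω => by simpa using hK v (B 0 ω)
  have hc : Continuous c := by
    refine continuous_of_dominated (fun v => (hmeas v).coe_nnreal_real.aestronglyMeasurable)
      hbound (integrable_const _) (ae_of_all _ fun ω => ?_)
    exact NNReal.continuous_coe.comp (hφ1 _)
  have hc0 : ∀ v, 0 ≤ c v := fun v => integral_nonneg fun ω => by positivity
  have hcl : ∀ v, ∫⁻ ω, (φ v (B 0 ω) : ℝ≥0∞) ∂P = ((c v).toNNReal : ℝ≥0∞) := by
    intro v
    have hint : Integrable (fun ω => (φ v (B 0 ω) : ℝ)) P :=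
      Integrable.of_bound (hmeas v).coe_nnreal_real.aestronglyMeasurable K (hbound v)
    have := ofReal_integral_eq_lintegral_ofReal hint (ae_of_all _ fun ω => by positivity)
    simp only [ENNReal.ofReal_coe_nnreal] at this
    rw [← this]; rfl
  have hmt : ∀ m : ℕ, ((m + 1 : ℕ) : ℝ≥0) * (t / (m + 1 : ℕ)) = t := fun m => by field_simp
  -- the identity along the grids
  have hgrid : ∀ m : ℕ, ∫⁻ ω, ∏ i ∈ Finset.range (N t ω),
        (φ (gridEpoch (t / (m + 1 : ℕ)) (m + 1) (fun u => N u ω) i) (B i ω) : ℝ≥0∞) ∂P =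
      ENNReal.ofReal (Real.exp (ν * ((∑ j ∈ Finset.range (m + 1),
        (t : ℝ) / (m + 1 : ℕ) * c ((j + 1 : ℕ) * (t / (m + 1 : ℕ)))) - t))) := by
    intro m
    have h1 := lintegral_prod_marks (P := P) (Z := fun ω t => N t ω) hΛ.measurable_path
      hΛ.measurable_shot hΛ.shot_indep hΛ.shot_ident hΛ.indep (k := fun p => p t)
      (measurable_pi_apply t)
      (τ := fun i p => gridEpoch (t / (m + 1 : ℕ)) (m + 1) p i)
      (fun i => measurable_gridEpoch _ _ i)
      (φ := fun v b => (φ v b : ℝ≥0∞))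
      ((hφ.measurable.comp (by fun_prop :
        Measurable fun q : ℝ≥0 × ℝ => ((q.1 : ℝ), q.2))).coe_nnreal_ennreal)
    have h2 := hΛ.poisson.lintegral_prod_gridEpoch (fun v => (c v).toNNReal)
      (t / (m + 1 : ℕ)) (m + 1)
    rw [hmt] at h2
    simp only [hcl] at h1
    rw [h1, h2]
    have hmt' : ((m + 1 : ℕ) : ℝ) * ((t / (m + 1 : ℕ) : ℝ≥0) : ℝ) = t := by
      exact_mod_cast congrArg NNReal.toReal (hmt m)
    rw [hmt']
    simp [Real.coe_toNNReal _ (hc0 _)]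
  have hlim1 : Tendsto (fun m : ℕ => ∫⁻ ω, ∏ i ∈ Finset.range (N t ω),
        (φ (gridEpoch (t / (m + 1 : ℕ)) (m + 1) (fun u => N u ω) i) (B i ω) : ℝ≥0∞) ∂P) atTop
      (𝓝 (∫⁻ ω, ∏ i ∈ Finset.range (N t ω), (φ (epoch N (i + 1) ω) (B i ω) : ℝ≥0∞) ∂P)) := by
    -- The dominating function `K ^ N t` has finite expectation, since the Poisson generating
    -- function is finite everywhere.
    refine tendsto_lintegral_of_dominated_convergence' (fun ω => (K : ℝ≥0∞) ^ N t ω)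
      (fun m => ?_) (fun m => ae_of_all _ fun ω => ?_) ?_ ?_
    · exact (hΛ.measurable_prod_gridEpoch t _ _ hφ.measurable).aemeasurable
    · refine (Finset.prod_le_prod' fun i _ => ENNReal.coe_le_coe.2 (hK _ _)).trans ?_
      simp
    · rw [hΛ.poisson.lintegral_pow]; exact ENNReal.ofReal_ne_top
    · filter_upwards [hΛ.tendsto_gridEpoch t] with ω h using tendsto_prod_of_tendsto hφ h
  simp only [hgrid] at hlim1
  refine tendsto_nhds_unique hlim1 ?_
  have hR := tendsto_riemannSum hc t.coe_nonneg
  exact ENNReal.tendsto_ofReal ((Real.continuous_exp.tendsto _).comp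
    ((hR.sub_const _).const_mul _))

end IsShotNoise

/-! ### The exponent as a sum over points -/

namespace PiecewiseContinuous

variable {g : ℝ → ℝ}

/-- The discontinuity set is countable, hence measurable and null, and `g` is continuous on its
complement. -/
lemma aestronglyMeasurable (hg : PiecewiseContinuous g) : AEStronglyMeasurable g volume := by
  have hcont : ContinuousOn g {x | ¬ ContinuousAt g x}ᶜ := fun x hx =>
    (not_not.1 hx : ContinuousAt g x).continuousWithinAt
  have h := hcont.aestronglyMeasurable (μ := volume) hg.countable.measurableSet.compl
  rwa [Measure.restrict_eq_self_of_ae_mem] at h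
  exact compl_mem_ae_iff.2 (hg.countable.measure_zero _)

lemma intervalIntegrable (hg : PiecewiseContinuous g) (a b : ℝ) :
    IntervalIntegrable g volume a b := by
  obtain ⟨C, hC⟩ := hg.bounded (min a b) (max a b)
  rw [intervalIntegrable_iff]
  refine Measure.integrableOn_of_bounded (M := C) (by simp [Set.uIoc])
    hg.aestronglyMeasurable ?_
  filter_upwards [ae_restrict_mem measurableSet_uIoc] with x hx
  exact hC x ⟨hx.1.le, hx.2⟩

lemma intervalIntegrable_mul_exp (hg : PiecewiseContinuous g) (r a b : ℝ) :
    IntervalIntegrable (fun u => g u * Real.exp (-r * u)) volume a b :=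
  (hg.intervalIntegrable a b).mul_continuousOn (by fun_prop)

/-- The primitive is continuous even where `g` jumps. This continuity is what allows rounded epochs
to be replaced by true ones in the limit. -/
lemma continuous_transformArg (hg : PiecewiseContinuous g) (r s t : ℝ) :
    Continuous (transformArg r g s t) := by
  have h := intervalIntegral.continuous_primitive (μ := volume)
    (hg.intervalIntegrable_mul_exp r) t
  have h' : Continuous fun v => ∫ u in v..t, g u * Real.exp (-r * u) :=
    h.neg.congr fun v => (intervalIntegral.integral_symm t v).symm
  unfold transformArg
  fun_prop

end PiecewiseContinuous

/-- Interval integrals live on `Ioc`, so the closed ray is first exchanged for the open one, at the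
cost of a null point. -/
lemma intervalIntegral_indicator_Ici {k : ℝ → ℝ} {a b c : ℝ} (hac : a ≤ c) (hcb : c ≤ b) :
    ∫ u in a..b, (Set.Ici c).indicator k u = ∫ u in c..b, k u := by
  have h : (Set.Ici c).indicator k =ᵐ[volume] (Set.Ioi c).indicator k :=
    indicator_ae_eq_of_ae_eq_set Ioi_ae_eq_Ici.symm
  rw [intervalIntegral.integral_of_le (hac.trans hcb), intervalIntegral.integral_of_le hcb,
    integral_congr_ae (ae_restrict_of_ae h), setIntegral_indicator measurableSet_Ioi,
    Set.Ioc_inter_Ioi, max_eq_right hac]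

namespace IsShotNoise

variable {Ω : Type*} [MeasurableSpace Ω] {P : Measure Ω} {r : ℝ}
  {ν : ℝ≥0} {N : ℝ≥0 → Ω → ℕ} {B : ℕ → Ω → ℝ} {Λ : ℝ≥0 → Ω → ℝ}

/-- The path integral exists, and the exponent is a sum over the points up to time `t`. -/
lemma pathExponent_eq (hΛ : IsShotNoise P r ν N B Λ) {g : ℝ → ℝ} (hg : PiecewiseContinuous g)
    (s : ℝ) (t : ℝ≥0) :
    ∀ᵐ ω ∂P, IntervalIntegrable (fun u => g u * Λ u.toNNReal ω) volume 0 t ∧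
      pathExponent Λ g s t ω =
        ∑ i ∈ Finset.range (N t ω), B i ω * -transformArg r g s t (epoch N (i + 1) ω) := by
  filter_upwards [hΛ.poisson.mono, hΛ.poisson.rightCts, hΛ.eq_shotSum] with ω hmono hrc hsum
  set T : ℕ → ℝ := fun i => (epoch N (i + 1) ω : ℝ) with hT
  have hT0 : ∀ i, 0 ≤ T i := fun i => NNReal.coe_nonneg _
  have hTt : ∀ i ∈ Finset.range (N t ω), T i ≤ t := fun i hi =>
    NNReal.coe_le_coe.2 ((epoch_le_iff hmono hrc (Finset.mem_range.1 hi) t).2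
      (Finset.mem_range.1 hi))
  set k : ℝ → ℝ := fun u => g u * Real.exp (-r * u) with hk
  -- The number of shots present depends on `u`. Indicators of `[T i, ∞)` turn the shot sum into one
  -- over a fixed finite range, which can be integrated termwise.
  have hpath : ∀ u ∈ Set.uIcc (0 : ℝ) t, g u * Λ u.toNNReal ω =
      ∑ i ∈ Finset.range (N t ω), B i ω * Real.exp (r * T i) * (Set.Ici (T i)).indicator k u := by
    intro u hu
    rw [Set.uIcc_of_le t.coe_nonneg] at hu
    have hut : u.toNNReal ≤ t := Real.toNNReal_le_iff_le_coe.2 hu.2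
    have hsub : Finset.range (N u.toNNReal ω) ⊆ Finset.range (N t ω) :=
      Finset.range_subset_range.2 (hmono hut)
    rw [hsum, shotSum, Finset.mul_sum, Real.coe_toNNReal _ hu.1]
    refine Finset.sum_subset_zero_on_sdiff hsub (fun i hi => ?_) fun i hi => ?_
    · obtain ⟨hi1, hi2⟩ := Finset.mem_sdiff.1 hi
      have hlt : ¬ T i ≤ u := fun h => hi2 (Finset.mem_range.2
        ((epoch_le_iff hmono hrc (Finset.mem_range.1 hi1) _).1 (NNReal.le_toNNReal_of_coe_le h)))
      rw [Set.indicator_of_notMem (by simpa using hlt), mul_zero]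
    · have hle : T i ≤ u := by
        have := (epoch_le_iff hmono hrc (Finset.mem_range.1 hi) _).2 (Finset.mem_range.1 hi)
        exact (Real.le_toNNReal_iff_coe_le hu.1).1 this
      have hexp : Real.exp (-r * (u - T i)) = Real.exp (r * T i) * Real.exp (-r * u) := by
        rw [← Real.exp_add]; ring_nf
      rw [Set.indicator_of_mem (by simpa using hle), hk]
      change g u * (B i ω * Real.exp (-r * (u - T i))) = _
      rw [hexp]; ring
  have hint : ∀ i ∈ Finset.range (N t ω), IntervalIntegrable
      (fun u => B i ω * Real.exp (r * T i) * (Set.Ici (T i)).indicator k u) volume 0 t := by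
    intro i _
    refine IntervalIntegrable.const_mul ?_ _
    have hki := hg.intervalIntegrable_mul_exp r 0 t
    exact ⟨hki.1.indicator measurableSet_Ici, hki.2.indicator measurableSet_Ici⟩
  have hsumint : IntervalIntegrable (fun u => ∑ i ∈ Finset.range (N t ω),
      B i ω * Real.exp (r * T i) * (Set.Ici (T i)).indicator k u) volume 0 t := by
    have := IntervalIntegrable.sum _ hint
    refine this.congr fun u _ => ?_
    simp
  refine ⟨hsumint.congr fun u hu => (hpath u (Set.uIoc_subset_uIcc hu)).symm, ?_⟩
  rw [pathExponent, intervalIntegral.integral_congr hpath,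
    intervalIntegral.integral_finsetSum hint, Real.toNNReal_coe, hsum, shotSum, Finset.mul_sum,
    ← Finset.sum_sub_distrib]
  refine Finset.sum_congr rfl fun i hi => ?_
  -- The coefficient of `B i` is `e^{rT} ∫_T^t k - s e^{-r(t-T)}`, which is `-θ(T)`.
  rw [intervalIntegral.integral_const_mul, intervalIntegral_indicator_Ici (hT0 i) (hTt i hi),
    transformArg]
  ring

end IsShotNoise

/-! ### Truncation and the identity in `[0, ∞]` -/

/-- Adding a finite constant and multiplying by a nonzero finite one avoid the discontinuities of
extended arithmetic. The limit of truncated integrals can thus be taken inside the right-hand side,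
also when it is `∞`. -/
lemma EReal.continuous_exp_mul_sub {a : ℝ} (ha : 0 < a) (t : ℝ) :
    Continuous fun x : ℝ≥0∞ => EReal.exp (a * ((x : EReal) - t)) := by
  refine ENNReal.continuous_exp.comp (continuous_iff_continuousAt.2 fun x => ?_)
  have h1 : ContinuousAt (fun x : ℝ≥0∞ => (x : EReal) - t) x := by
    simp only [sub_eq_add_neg, ← EReal.coe_neg]
    exact ContinuousAt.comp (f := fun x : ℝ≥0∞ => ((x : EReal), ((-t : ℝ) : EReal)))
      (EReal.continuousAt_add (by simp) (by simp))
      (continuous_coe_ennreal_ereal.continuousAt.prodMk continuousAt_const)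
  have ha' : (a : EReal) ≠ 0 := by exact_mod_cast ha.ne'
  exact ContinuousAt.comp (f := fun x : ℝ≥0∞ => ((a : EReal), (x : EReal) - t))
    (EReal.continuousAt_mul (by simp [ha']) (by simp [ha']) (by simp) (by simp))
    (continuousAt_const.prodMk h1)

/-- The value at `b` of `b ↦ exp (-x b)`, truncated at the level `n`. -/
noncomputable def truncExp (n : ℕ) (x b : ℝ) : ℝ≥0 :=
  min (Real.exp (-x * b)).toNNReal n

lemma continuous_truncExp (n : ℕ) : Continuous (Function.uncurry (truncExp n)) := by
  unfold truncExp Function.uncurry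
  fun_prop

lemma truncExp_le (n : ℕ) (x b : ℝ) : truncExp n x b ≤ n := min_le_right _ _

lemma monotone_truncExp (x b : ℝ) : Monotone fun n => truncExp n x b := fun m n hmn =>
  min_le_min_left _ (by exact_mod_cast hmn)

lemma eventually_truncExp_eq (x b : ℝ) :
    ∀ᶠ n in atTop, (truncExp n x b : ℝ≥0∞) = ENNReal.ofReal (Real.exp (-x * b)) := by
  obtain ⟨M, hM⟩ := exists_nat_ge (Real.exp (-x * b)).toNNReal
  filter_upwards [eventually_ge_atTop M] with n hn
  have : (Real.exp (-x * b)).toNNReal ≤ n := hM.trans (by exact_mod_cast hn)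
  rw [truncExp, min_eq_left this]; rfl

lemma measurable_transform_comp {Ω : Type*} [MeasurableSpace Ω] {P : Measure Ω}
    [SFinite P] {B : Ω → ℝ} (hB : Measurable B) {θ : ℝ → ℝ} (hθ : Measurable θ) :
    Measurable fun v => transform P B (θ v) := by
  have h : Measurable fun q : ℝ × Ω => ENNReal.ofReal (Real.exp (-θ q.1 * B q.2)) := by fun_prop
  exact h.lintegral_prod_right'

namespace IsShotNoise

variable {Ω : Type*} [MeasurableSpace Ω] {P : Measure Ω} [IsProbabilityMeasure P] {r : ℝ}
  {ν : ℝ≥0} {N : ℝ≥0 → Ω → ℕ} {B : ℕ → Ω → ℝ} {Λ : ℝ≥0 → Ω → ℝ}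

/-- The exponential formula for sums over the marked points up to time `t`. -/
lemma lintegral_exp_sum_epoch (hΛ : IsShotNoise P r ν N B Λ) (t : ℝ≥0) {θ : ℝ → ℝ}
    (hθ : Continuous θ) :
    ∫⁻ ω, ENNReal.ofReal (Real.exp
        (∑ i ∈ Finset.range (N t ω), B i ω * -θ (epoch N (i + 1) ω))) ∂P =
      EReal.exp ((ν : ℝ) * (((∫⁻ v in Set.Icc (0 : ℝ) t, transform P (B 0) (θ v) : ℝ≥0∞) : EReal)
        - (t : ℝ))) := by
  have hprod : ∀ ω, ENNReal.ofReal (Real.exp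
        (∑ i ∈ Finset.range (N t ω), B i ω * -θ (epoch N (i + 1) ω))) =
      ∏ i ∈ Finset.range (N t ω),
        ENNReal.ofReal (Real.exp (-θ (epoch N (i + 1) ω) * B i ω)) := fun ω => by
    rw [Real.exp_sum, ENNReal.ofReal_prod_of_nonneg fun _ _ => (Real.exp_pos _).le]
    simp only [mul_comm]
  simp only [hprod]
  have hmeasB : ∀ n v, Measurable fun ω => truncExp n (θ v) (B 0 ω) := fun n v =>
    (continuous_truncExp n).measurable.comp (measurable_const.prodMk (hΛ.measurable_shot 0))
  set c : ℕ → ℝ → ℝ := fun n v => ∫ ω, (truncExp n (θ v) (B 0 ω) : ℝ) ∂P with hc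
  have hφ : ∀ n, Continuous (Function.uncurry fun v b => truncExp n (θ v) b) := fun n =>
    (continuous_truncExp n).comp (by fun_prop : Continuous fun q : ℝ × ℝ => (θ q.1, q.2))
  have hcl : ∀ n v, ∫⁻ ω, (truncExp n (θ v) (B 0 ω) : ℝ≥0∞) ∂P = ENNReal.ofReal (c n v) := by
    intro n v
    have hint : Integrable (fun ω => (truncExp n (θ v) (B 0 ω) : ℝ)) P :=
      Integrable.of_bound (hmeasB n v).coe_nnreal_real.aestronglyMeasurable n
        (ae_of_all _ fun ω => by
          simpa using NNReal.coe_le_coe.2 <| truncExp_le n (θ v) (B 0 ω))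
    have := ofReal_integral_eq_lintegral_ofReal hint (ae_of_all _ fun ω => by positivity)
    simp only [ENNReal.ofReal_coe_nnreal] at this
    exact this.symm
  have hcc : ∀ n, Continuous (c n) := fun n => by
    refine continuous_of_dominated (bound := fun _ => (n : ℝ))
      (fun v => (hmeasB n v).coe_nnreal_real.aestronglyMeasurable)
      (fun v => ae_of_all _ fun ω => by
          simpa using NNReal.coe_le_coe.2 <| truncExp_le n (θ v) (B 0 ω))
      (integrable_const _) (ae_of_all _ fun ω => ?_)
    exact NNReal.continuous_coe.comp
      ((hφ n).comp (by fun_prop : Continuous fun v : ℝ => (v, B 0 ω)))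
  have hc0 : ∀ n v, 0 ≤ c n v := fun n v => integral_nonneg fun ω => by positivity
  -- the truncated identity
  have htrunc : ∀ n, ∫⁻ ω, ∏ i ∈ Finset.range (N t ω),
        (truncExp n (θ (epoch N (i + 1) ω)) (B i ω) : ℝ≥0∞) ∂P =
      EReal.exp ((ν : ℝ) * (((∫⁻ v in Set.Icc (0 : ℝ) t, ENNReal.ofReal (c n v) : ℝ≥0∞) : EReal)
        - (t : ℝ))) := by
    intro n
    rw [hΛ.lintegral_prod_epoch t (hφ n) (fun v b => truncExp_le n (θ v) b),
      ← ofReal_integral_eq_lintegral_ofReal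
        ((hcc n).continuousOn.integrableOn_compact isCompact_Icc) (ae_of_all _ (hc0 n)),
      EReal.coe_ennreal_ofReal, max_eq_left (integral_nonneg (hc0 n)),
      integral_Icc_eq_integral_Ioc, ← intervalIntegral.integral_of_le t.coe_nonneg]
    rw [← EReal.coe_sub, ← EReal.coe_mul, EReal.exp_coe]
  have hleft : Tendsto (fun n => ∫⁻ ω, ∏ i ∈ Finset.range (N t ω),
        (truncExp n (θ (epoch N (i + 1) ω)) (B i ω) : ℝ≥0∞) ∂P) atTop
      (𝓝 (∫⁻ ω, ∏ i ∈ Finset.range (N t ω),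
        ENNReal.ofReal (Real.exp (-θ (epoch N (i + 1) ω) * B i ω)) ∂P)) := by
    refine lintegral_tendsto_of_tendsto_of_monotone (fun n => ?_) (ae_of_all _ fun ω => ?_)
      (ae_of_all _ fun ω => ?_)
    · exact hΛ.aemeasurable_prod_epoch t (hφ n)
    · intro m n hmn
      exact Finset.prod_le_prod' fun i _ => ENNReal.coe_le_coe.2 (monotone_truncExp _ _ hmn)
    -- For fixed `ω` there are finitely many factors, and each truncation is eventually inactive, so
    -- the product is eventually constant in `n`.
    · refine tendsto_const_nhds.congr' ?_
      have := (Filter.eventually_all_finset (Finset.range (N t ω))).2 fun i _ =>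
        eventually_truncExp_eq (θ (epoch N (i + 1) ω)) (B i ω)
      filter_upwards [this] with n hn
      exact (Finset.prod_congr rfl hn).symm
  have hright : Tendsto (fun n => ∫⁻ v in Set.Icc (0 : ℝ) t, ENNReal.ofReal (c n v)) atTop
      (𝓝 (∫⁻ v in Set.Icc (0 : ℝ) t, transform P (B 0) (θ v))) := by
    have hmono : ∀ v, Monotone fun n => ENNReal.ofReal (c n v) := fun v m n hmn => by
      simp only [← hcl]
      exact lintegral_mono fun ω => ENNReal.coe_le_coe.2 (monotone_truncExp _ _ hmn)
    refine lintegral_tendsto_of_tendsto_of_monotone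
      (fun n => (hcc n).measurable.ennreal_ofReal.aemeasurable) (ae_of_all _ hmono)
      (ae_of_all _ fun v => ?_)
    simp only [← hcl]
    refine lintegral_tendsto_of_tendsto_of_monotone
      (fun n => (hmeasB n v).coe_nnreal_ennreal.aemeasurable) (ae_of_all _ fun ω m n hmn =>
        ENNReal.coe_le_coe.2 (monotone_truncExp _ _ hmn)) (ae_of_all _ fun ω => ?_)
    refine tendsto_const_nhds.congr' ?_
    filter_upwards [eventually_truncExp_eq (θ v) (B 0 ω)] with n hn using hn.symm
  simp only [htrunc] at hleft
  exact tendsto_nhds_unique hleft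
    (((EReal.continuous_exp_mul_sub (NNReal.coe_pos.2 hΛ.rate_pos) t).tendsto _).comp hright)

end IsShotNoise

/-! ### The transform identity -/

theorem mainTheorem4 {Ω : Type*} [MeasurableSpace Ω] (P : Measure Ω) [IsProbabilityMeasure P]
    (r : ℝ) (ν : ℝ≥0) (N : ℝ≥0 → Ω → ℕ) (B : ℕ → Ω → ℝ) (Λ : ℝ≥0 → Ω → ℝ)
    (hΛ : IsShotNoise P r ν N B Λ)
    (d : ℕ) (f : ℝ × (Fin d → ℝ) → ℝ) (hf : ∀ z, PiecewiseContinuous fun u => f (u, z))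
    (z : Fin d → ℝ) (s t : ℝ) (ht : 0 ≤ t) :
    -- the path integral and its exponential are well defined
    (∀ᵐ ω ∂P, IntervalIntegrable (fun u => f (u, z) * Λ u.toNNReal ω) volume 0 t) ∧
    AEMeasurable (pathExponent Λ (fun u => f (u, z)) s t) P ∧
    -- the identity in `[0, ∞]`, without any finiteness assumption
    ∫⁻ ω, ENNReal.ofReal (Real.exp (pathExponent Λ (fun u => f (u, z)) s t ω)) ∂P =
      EReal.exp ((ν : ℝ) *
        (((∫⁻ v in Set.Icc 0 t, transform P (B 0) (transformArg r (fun u => f (u, z)) s t v) :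
          ℝ≥0∞) : EReal) - (t : ℝ))) ∧
    -- the two sides are finite together
    (Integrable (fun ω => Real.exp (pathExponent Λ (fun u => f (u, z)) s t ω)) P ↔
      ∫⁻ v in Set.Icc 0 t, transform P (B 0) (transformArg r (fun u => f (u, z)) s t v) ≠ ∞) ∧
    -- and then the identity holds between real numbers
    (∫⁻ v in Set.Icc 0 t, transform P (B 0) (transformArg r (fun u => f (u, z)) s t v) ≠ ∞ →
      IntervalIntegrable (fun v =>
        (transform P (B 0) (transformArg r (fun u => f (u, z)) s t v)).toReal - 1) volume 0 t ∧
      ∫ ω, Real.exp (pathExponent Λ (fun u => f (u, z)) s t ω) ∂P =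
        Real.exp (ν * ∫ v in (0 : ℝ)..t,
          ((transform P (B 0) (transformArg r (fun u => f (u, z)) s t v)).toReal - 1))) := by
  lift t to ℝ≥0 using ht
  set g : ℝ → ℝ := fun u => f (u, z)
  have hg : PiecewiseContinuous g := hf z
  have hθ := hg.continuous_transformArg r s t
  have hpath := hΛ.pathExponent_eq hg s t
  have hX : AEMeasurable (pathExponent Λ g s t) P :=
    (hΛ.aemeasurable_sum_epoch t hθ.neg).congr (hpath.mono fun ω h => h.2.symm)
  have hid : ∫⁻ ω, ENNReal.ofReal (Real.exp (pathExponent Λ g s t ω)) ∂P =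
      EReal.exp ((ν : ℝ) *
        (((∫⁻ v in Set.Icc (0 : ℝ) t, transform P (B 0) (transformArg r g s t v) : ℝ≥0∞) :
          EReal) - (t : ℝ))) := by
    rw [← hΛ.lintegral_exp_sum_epoch t hθ]
    refine lintegral_congr_ae (hpath.mono fun ω h => ?_)
    simp only [h.2]
  have hfin : EReal.exp ((ν : ℝ) *
        (((∫⁻ v in Set.Icc (0 : ℝ) t, transform P (B 0) (transformArg r g s t v) : ℝ≥0∞) :
          EReal) - (t : ℝ))) ≠ ∞ ↔
      ∫⁻ v in Set.Icc (0 : ℝ) t, transform P (B 0) (transformArg r g s t v) ≠ ∞ := by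
    generalize ∫⁻ v in Set.Icc (0 : ℝ) t, transform P (B 0) (transformArg r g s t v) = I
    have hν : (0 : ℝ) < ν := NNReal.coe_pos.2 hΛ.rate_pos
    induction I with
    -- Positivity of the rate gives `ν (∞ - t) = ∞`, so an infinite integral forces an infinite
    -- right-hand side.
    | top => simp [EReal.coe_mul_top_of_pos hν]
    | coe x =>
      have : ((x : ℝ≥0∞) : EReal) = ((x : ℝ) : EReal) := rfl
      rw [this, ← EReal.coe_sub, ← EReal.coe_mul, EReal.exp_coe]
      simp
  have hexp : AEStronglyMeasurable (fun ω => Real.exp (pathExponent Λ g s t ω)) P :=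
    (Real.measurable_exp.comp_aemeasurable hX).aestronglyMeasurable
  have hexp0 : 0 ≤ᵐ[P] fun ω => Real.exp (pathExponent Λ g s t ω) :=
    ae_of_all _ fun ω => (Real.exp_pos _).le
  refine ⟨hpath.mono fun ω h => h.1, hX, hid, ?_, fun hI => ?_⟩
  · rw [← lintegral_ofReal_ne_top_iff_integrable hexp hexp0, hid, hfin]
  · have hβ := measurable_transform_comp (P := P) (hΛ.measurable_shot 0) hθ.measurable
    have hβint : IntervalIntegrable (fun v =>
        (transform P (B 0) (transformArg r g s t v)).toReal) volume 0 t := by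
      rw [intervalIntegrable_iff_integrableOn_Icc_of_le t.coe_nonneg]
      exact integrable_toReal_of_lintegral_ne_top hβ.aemeasurable hI
    refine ⟨hβint.sub intervalIntegrable_const, ?_⟩
    -- Where the transform is infinite, `toReal` returns `0`; finiteness of its integral makes that
    -- set null, so passing to real values loses nothing.
    rw [integral_eq_lintegral_of_nonneg_ae hexp0 hexp, hid,
      intervalIntegral.integral_sub hβint intervalIntegrable_const,
      intervalIntegral.integral_of_le t.coe_nonneg, ← integral_Icc_eq_integral_Ioc,
      integral_toReal hβ.aemeasurable (ae_lt_top hβ hI), ← EReal.coe_toReal (by simpa using hI)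
        (EReal.coe_ennreal_ne_bot _), EReal.toReal_coe_ennreal, ← EReal.coe_sub, ← EReal.coe_mul,
      EReal.exp_coe, ENNReal.toReal_ofReal (Real.exp_pos _).le]
    simp
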